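/- **Theorem 3.13 (Quantitative Prokhorov's Theorem).** A *cdf* is a non-decreasing right-continuous function $F:\mathbb R\to\mathbb R$ with $\lim_{x\to-\infty}F(x)=0$ and $\lim_{x\to\infty}F(x)=1$. Let $\mathcal F$ be the set of all cdfs, $\mathcal F_c$ the set of continuous ones, $D_u(F,G)=\sup_{x\in\mathbb R}|F(x)-G(x)|$, and $(F\star G)(x)=\int_{-\infty}^{\infty}F(x-y)\,dG(y)$. An *approach system* on a set $X$ assigns to each $x\in X$ a nonempty set $\mathcal A_x$ of functions $X\to[0,\infty]$, closed under finite suprema and under passing to smaller functions, such that (i) $\phi(x)=0$ for all $\phi\in\mathcal A_x$; (ii) if $\phi:X\to[0,\infty]$ is such that for all $\epsilon>0$ and $\omega<\infty$ there is $\psi\in\mathcal A_x$ with $\min\{\phi,\omega\}\le\psi+\epsilon$, then $\phi\in\mathcal A_x$; (iii) for all $\phi\in\mathcal A_x$, $\epsilon>0$, $\omega<\infty$ there is $(\phi_z)_{z\in X}$ with $\phi_z\in\mathcal A_z$ for every $z\in X$ and $\min\{\phi(y),\omega\}\le\phi_x(z)+\phi_z(y)+\epsilon$ for all $y,z\in X$.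 A metric $d$ on $X$ gives the approach system with $\mathcal A_x=\{\phi\mid\phi\le d(x,\cdot)\}$. Given maps $f_i:X\to Y_i$ into sets with approach systems, the *initial* approach system on $X$ is the one for which $\phi\in\mathcal A_x$ if and only if for all $\epsilon>0$ and $\omega<\infty$ there are a finite set $J$ of indices and $\psi_i\in(\mathcal A_{Y_i})_{f_i(x)}$ ($i\in J$) with $\min\{\phi,\omega\}\le\sup_{i\in J}\psi_i\circ f_i+\epsilon$. The *continuity approach structure* $\mathcal A_c$ on $\mathcal F$ is the initial approach system for the maps $\mathcal F\to\mathcal F_c$, $F\mapsto F\star G$, with $G$ running through $\mathcal F_c$, where $\mathcal F_c$ carries the approach system of the metric $D_u$. For an approach system $\mathcal A$ on $X$ and $\alpha>0$, a sequence $(x_n)$ is *$\alpha$-convergent* to $x$ if for every $\phi\in\mathcal A_x$ one has $\phi(x_n)<\alpha$ for all sufficiently large $n$. A set $A\subset X$ is *$\alpha$-relatively sequentially compact* if every sequence in $A$ has a subsequence that is $\alpha$-convergent to some point of $X$; put $\chi_{rsc}(A)=\inf\{\alpha>0\mid A\text{ is }\alpha\text{-relatively sequentially compact}\}$. Then for every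 set $\mathcal D\subset\mathcal F$, with $\chi_{rsc}$ taken in $(\mathcal F,\mathcal A_c)$, $$\chi_{rsc}(\mathcal D)=\chi_e(\mathcal D):=\inf_{M>0}\ \sup_{F\in\mathcal D}\ \max\{F(-M),\,1-F(M)\},$$ where the supremum over the empty set is taken to be $0$. -/

import Mathlib

open Filter Topology MeasureTheory
open scoped ENNReal

noncomputable section

/-- An approach system on `X`: to each point `x` an ideal `system x` of functions `X → [0,∞]`
(nonempty, closed under binary suprema and under passing to smaller functions) of local distances
from `x`, which vanish at `x`, is saturated, and satisfies the mixed triangle inequality. -/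
structure ApproachSystem (X : Type*) where
  system : X → Set (X → ℝ≥0∞)
  nonempty : ∀ x, (system x).Nonempty
  sup_mem : ∀ x, ∀ φ ∈ system x, ∀ ψ ∈ system x, φ ⊔ ψ ∈ system x
  mem_of_le : ∀ x, ∀ φ ∈ system x, ∀ ψ, ψ ≤ φ → ψ ∈ system x
  apply_self : ∀ x, ∀ φ ∈ system x, φ x = 0
  saturated : ∀ x (φ : X → ℝ≥0∞),
    (∀ ε : ℝ≥0∞, 0 < ε → ∀ ω : ℝ≥0∞, ω < ∞ →
      ∃ ψ ∈ system x, ∀ y, min (φ y) ω ≤ ψ y + ε) → φ ∈ system x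
  triangle : ∀ x, ∀ φ ∈ system x, ∀ ε : ℝ≥0∞, 0 < ε → ∀ ω : ℝ≥0∞, ω < ∞ →
    ∃ Φ : X → X → ℝ≥0∞, (∀ z, Φ z ∈ system z) ∧
      ∀ z y, min (φ y) ω ≤ Φ x z + Φ z y + ε

namespace ApproachSystem

/-- The sequence `u` is `ε`-convergent to `x`: every ball with center `x` and radius `ε`, that is,
every set `{y | φ y < ε}` with `φ` in the approach system at `x`, contains `u n` for all
sufficiently large `n`. -/
def ConvergesUpTo {X : Type*} (S : ApproachSystem X) (ε : ℝ) (u : ℕ → X) (x : X) : Prop :=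
  ∀ φ ∈ S.system x, ∀ᶠ n in atTop, φ (u n) < ENNReal.ofReal ε

/-- `A` is `ε`-relatively sequentially compact: each sequence in `A` has a subsequence which is
`ε`-convergent to some point of the space. -/
def IsRelSeqCompactUpTo {X : Type*} (S : ApproachSystem X) (ε : ℝ) (A : Set X) : Prop :=
  ∀ u : ℕ → X, (∀ n, u n ∈ A) →
    ∃ k : ℕ → ℕ, StrictMono k ∧ ∃ x : X, S.ConvergesUpTo ε (u ∘ k) x

/-- The relative sequential compactness index of `A`, with values in `[0,∞]`. -/
def relSeqCompactIndex {X : Type*} (S : ApproachSystem X) (A : Set X) : ℝ≥0∞ :=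
  ⨅ (α : ℝ) (_ : 0 < α) (_ : S.IsRelSeqCompactUpTo α A), ENNReal.ofReal α

/-- The approach system underlying a `[0,∞]`-valued (quasi-)metric `d`: the local distances at `x`
are the functions below `d x`. -/
def ofDist {X : Type*} (d : X → X → ℝ≥0∞) (d_self : ∀ x, d x x = 0)
    (d_triangle : ∀ x z y, d x y ≤ d x z + d z y) : ApproachSystem X where
  system x := {φ | φ ≤ d x}
  nonempty x := ⟨d x, le_refl (d x)⟩
  sup_mem x φ hφ ψ hψ := show φ ⊔ ψ ≤ d x from sup_le hφ hψ
  mem_of_le _ _ hφ _ hle := le_trans hle hφ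
  apply_self x φ hφ := le_antisymm (le_trans (hφ x) (d_self x).le) bot_le
  saturated x φ h := by
    intro y
    refine le_of_forall_lt fun c hc => ?_
    obtain ⟨ω, hcω, hω⟩ := exists_between hc
    refine lt_of_lt_of_le hcω ?_
    refine ENNReal.le_of_forall_pos_le_add fun ε hε _ => ?_
    obtain ⟨ψ, hψ, hle⟩ := h ε (by exact_mod_cast hε) ω (lt_of_lt_of_le hω le_top)
    have h1 := hle y
    rw [min_eq_right hω.le] at h1
    exact h1.trans (by gcongr; exact hψ y)
  triangle x φ hφ ε _ ω _ :=
    ⟨d, fun z => le_refl (d z), fun z y =>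
      (min_le_left _ _).trans ((hφ y).trans ((d_triangle x z y).trans le_self_add))⟩

/-- The finite suprema of the functions `ψ ∘ f i`, where `ψ` is a local distance at `f i x`: the
standard basis at `x` of the initial approach system. -/
def initialBasis {X ι : Type*} {Y : ι → Type*} (S : ∀ i, ApproachSystem (Y i))
    (f : ∀ i, X → Y i) (x : X) : Set (X → ℝ≥0∞) :=
  {b | ∃ (J : Finset ι) (ψ : ∀ i, Y i → ℝ≥0∞),
    (∀ i ∈ J, ψ i ∈ (S i).system (f i x)) ∧ b = fun y => J.sup fun i => ψ i (f i y)}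

theorem sup_mem_initialBasis {X ι : Type*} {Y : ι → Type*} (S : ∀ i, ApproachSystem (Y i))
    (f : ∀ i, X → Y i) (x : X) {b c : X → ℝ≥0∞} (hb : b ∈ initialBasis S f x)
    (hc : c ∈ initialBasis S f x) : b ⊔ c ∈ initialBasis S f x := by
  classical
  obtain ⟨J, ψ, hψ, rfl⟩ := hb
  obtain ⟨K, θ, hθ, rfl⟩ := hc
  refine ⟨J ∪ K, fun i => (if i ∈ J then ψ i else ⊥) ⊔ (if i ∈ K then θ i else ⊥), ?_, ?_⟩
  · intro i hi
    by_cases h1 : i ∈ J <;> by_cases h2 : i ∈ K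
    · simpa [h1, h2] using (S i).sup_mem _ _ (hψ i h1) _ (hθ i h2)
    · simpa [h1, h2] using hψ i h1
    · simpa [h1, h2] using hθ i h2
    · simp [h1, h2] at hi
  · funext y
    apply le_antisymm
    · refine sup_le (Finset.sup_le fun i hi => ?_) (Finset.sup_le fun i hi => ?_)
      · refine le_trans ?_ (Finset.le_sup (Finset.mem_union_left K hi))
        simp [hi]
      · refine le_trans ?_ (Finset.le_sup (Finset.mem_union_right J hi))
        simp [hi]
    · refine Finset.sup_le fun i hi => ?_
      refine sup_le ?_ ?_
      · by_cases h1 : i ∈ J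
        · simp only [h1, if_true]
          exact le_sup_of_le_left (Finset.le_sup (f := fun i => ψ i (f i y)) h1)
        · simp [h1]
      · by_cases h1 : i ∈ K
        · simp only [h1, if_true]
          exact le_sup_of_le_right (Finset.le_sup (f := fun i => θ i (f i y)) h1)
        · simp [h1]

/-- The initial approach system on `X` for the source `(f i : X → (Y i, S i))`, i.e. the saturation
of `initialBasis`. -/
def initial {X ι : Type*} {Y : ι → Type*} (S : ∀ i, ApproachSystem (Y i))
    (f : ∀ i, X → Y i) : ApproachSystem X where
  system x := {φ | ∀ ε : ℝ≥0∞, 0 < ε → ∀ ω : ℝ≥0∞, ω < ∞ →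
    ∃ b ∈ initialBasis S f x, ∀ y, min (φ y) ω ≤ b y + ε}
  nonempty x := by
    refine ⟨fun _ => 0, fun ε _ ω _ => ⟨_, ⟨∅, fun _ _ => 0, by simp, rfl⟩, fun y => by simp⟩⟩
  sup_mem x φ hφ ψ hψ ε hε ω hω := by
    obtain ⟨b, hb, hle⟩ := hφ ε hε ω hω
    obtain ⟨c, hc, hle'⟩ := hψ ε hε ω hω
    refine ⟨b ⊔ c, sup_mem_initialBasis S f x hb hc, fun y => ?_⟩
    simp only [Pi.sup_apply, min_max_distrib_right]
    refine sup_le ((hle y).trans ?_) ((hle' y).trans ?_)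
    · gcongr; exact le_sup_left
    · gcongr; exact le_sup_right
  mem_of_le x φ hφ ψ hψ ε hε ω hω := by
    obtain ⟨b, hb, hle⟩ := hφ ε hε ω hω
    exact ⟨b, hb, fun y => (min_le_min_right ω (hψ y)).trans (hle y)⟩
  apply_self x φ hφ := by
    have key : min (φ x) 1 ≤ 0 := by
      refine ENNReal.le_of_forall_pos_le_add fun ε hε _ => ?_
      obtain ⟨b, ⟨J, ψ, hψ, rfl⟩, hle⟩ := hφ ε (by exact_mod_cast hε) 1 ENNReal.one_lt_top
      refine (hle x).trans ?_
      gcongr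
      exact Finset.sup_le fun i hi => ((S i).apply_self _ _ (hψ i hi)).le
    rcases min_le_iff.1 key with h | h
    · exact le_antisymm h bot_le
    · simp at h
  saturated x φ h ε hε ω hω := by
    obtain ⟨ψ, hψ, hle⟩ := h (ε / 2) (ENNReal.half_pos hε.ne') ω hω
    obtain ⟨b, hb, hle'⟩ := hψ (ε / 2) (ENNReal.half_pos hε.ne') ω hω
    refine ⟨b, hb, fun y => ?_⟩
    have h1 : min (φ y) ω ≤ min (ψ y) ω + ε / 2 := by
      rcases le_total (ψ y) ω with h0 | h0
      · rw [min_eq_left h0]; exact hle y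
      · rw [min_eq_right h0]; exact (min_le_right _ _).trans le_self_add
    calc min (φ y) ω ≤ min (ψ y) ω + ε / 2 := h1
      _ ≤ (b y + ε / 2) + ε / 2 := by gcongr; exact hle' y
      _ = b y + ε := by rw [add_assoc, ENNReal.add_halves]
  triangle x φ hφ ε hε ω hω := by
    classical
    obtain ⟨b, ⟨J, ψ, hψ, rfl⟩, hle⟩ := hφ (ε / 2) (ENNReal.half_pos hε.ne') ω hω
    have tri : ∀ i, ∃ Φ : Y i → Y i → ℝ≥0∞, (∀ z, Φ z ∈ (S i).system z) ∧
        (i ∈ J → ∀ z y, min (ψ i y) ω ≤ Φ (f i x) z + Φ z y + ε / 2) := by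
      intro i
      by_cases hi : i ∈ J
      · obtain ⟨Φ, h1, h2⟩ :=
          (S i).triangle _ _ (hψ i hi) (ε / 2) (ENNReal.half_pos hε.ne') ω hω
        exact ⟨Φ, h1, fun _ => h2⟩
      · choose Φ hΦ using (S i).nonempty
        exact ⟨Φ, hΦ, fun h => absurd h hi⟩
    choose Θ hΘ hΘle using tri
    refine ⟨fun z y => J.sup fun i => Θ i (f i z) (f i y), fun z ε' _ ω' _ => ?_, fun z y => ?_⟩
    · exact ⟨_, ⟨J, fun i => Θ i (f i z), fun i _ => hΘ i _, rfl⟩,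
        fun y => (min_le_left _ _).trans le_self_add⟩
    · have h1 : min (φ y) ω ≤ min (J.sup fun i => ψ i (f i y)) ω + ε / 2 := by
        rcases le_total (J.sup fun i => ψ i (f i y)) ω with h0 | h0
        · rw [min_eq_left h0]; exact hle y
        · rw [min_eq_right h0]; exact (min_le_right _ _).trans le_self_add
      have h2 : min (J.sup fun i => ψ i (f i y)) ω ≤
          (J.sup fun i => Θ i (f i x) (f i z)) + (J.sup fun i => Θ i (f i z) (f i y))
            + ε / 2 := by
        rw [Finset.sup_inf_distrib_right]
        refine Finset.sup_le fun i hi => (hΘle i hi (f i z) (f i y)).trans ?_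
        gcongr
        · exact Finset.le_sup (f := fun i => Θ i (f i x) (f i z)) hi
        · exact Finset.le_sup (f := fun i => Θ i (f i z) (f i y)) hi
      calc min (φ y) ω ≤ min (J.sup fun i => ψ i (f i y)) ω + ε / 2 := h1
        _ ≤ (((J.sup fun i => Θ i (f i x) (f i z)) + (J.sup fun i => Θ i (f i z) (f i y)))
            + ε / 2) + ε / 2 := by gcongr
        _ = _ := by rw [add_assoc _ (ε / 2), ENNReal.add_halves]

/-- Contractions, the morphisms of approach spaces. -/
def IsContraction {X Y : Type*} (S : ApproachSystem X) (T : ApproachSystem Y) (f : X → Y) :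
    Prop :=
  ∀ x, ∀ φ ∈ T.system (f x), φ ∘ f ∈ S.system x

/-- The universal property of the initial approach system: `g` into it is a contraction if and
only if all the maps `f i ∘ g` are. -/
theorem isContraction_initial_iff {X Z ι : Type*} {Y : ι → Type*}
    (S : ∀ i, ApproachSystem (Y i)) (f : ∀ i, X → Y i) (T : ApproachSystem Z) (g : Z → X) :
    T.IsContraction (initial S f) g ↔ ∀ i, T.IsContraction (S i) (f i ∘ g) := by
  constructor
  · intro h i z φ hφ
    refine h z (φ ∘ f i) fun ε _ ω _ => ?_
    classical
    refine ⟨_, ⟨{i}, fun j => if e : j = i then e ▸ φ else ⊥, ?_, rfl⟩, fun y => ?_⟩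
    · intro j hj
      obtain rfl := Finset.mem_singleton.1 hj
      simpa using hφ
    · simp
  · intro h z φ hφ
    refine T.saturated z _ fun ε hε ω hω => ?_
    obtain ⟨b, ⟨J, ψ, hψ, rfl⟩, hle⟩ := hφ ε hε ω hω
    refine ⟨fun w => J.sup fun i => ψ i (f i (g w)), ?_, fun w => hle (g w)⟩
    clear hle
    classical
    induction J using Finset.induction_on with
    | empty =>
      obtain ⟨θ, hθ⟩ := T.nonempty z
      exact T.mem_of_le z θ hθ _ (fun w => by simp)
    | insert i J _ ih =>
      simp only [Finset.sup_insert]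
      exact T.sup_mem z _ (h i z _ (hψ i (Finset.mem_insert_self i J))) _
        (ih fun j hj => hψ j (Finset.mem_insert_of_mem hj))

end ApproachSystem

/-- A cumulative distribution function: a non-decreasing right-continuous function `ℝ → ℝ`
(`StieltjesFunction ℝ`) with limit `0` at `-∞` and limit `1` at `∞`. -/
structure CDF extends StieltjesFunction ℝ where
  tendsto_atBot : Tendsto toStieltjesFunction atBot (𝓝 0)
  tendsto_atTop : Tendsto toStieltjesFunction atTop (𝓝 1)

namespace CDF

instance : CoeFun CDF (fun _ => ℝ → ℝ) := ⟨fun F => F.toStieltjesFunction⟩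

theorem nonneg (F : CDF) (x : ℝ) : 0 ≤ F x :=
  F.mono.le_of_tendsto F.tendsto_atBot x

theorem le_one (F : CDF) (x : ℝ) : F x ≤ 1 :=
  F.mono.ge_of_tendsto F.tendsto_atTop x

/-- The Lebesgue-Stieltjes measure `dF`. -/
def measure (F : CDF) : Measure ℝ := F.toStieltjesFunction.measure

instance (F : CDF) : IsProbabilityMeasure F.measure :=
  F.toStieltjesFunction.isProbabilityMeasure F.tendsto_atBot F.tendsto_atTop

theorem norm_le_one (F : CDF) (x : ℝ) : ‖F x‖ ≤ 1 := by
  rw [Real.norm_eq_abs, abs_of_nonneg (F.nonneg x)]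
  exact F.le_one x

theorem measurable_shift (F : CDF) (x : ℝ) : Measurable fun y => F (x - y) :=
  F.mono.measurable.comp (measurable_const.sub measurable_id)

theorem integrable_shift (F G : CDF) (x : ℝ) : Integrable (fun y => F (x - y)) G.measure :=
  (integrable_const (1 : ℝ)).mono' (F.measurable_shift x).aestronglyMeasurable
    (ae_of_all _ fun _ => F.norm_le_one _)

theorem tendsto_integral_shift (F G : CDF) {l : Filter ℝ} [l.IsCountablyGenerated] {g : ℝ → ℝ}
    (h : ∀ᵐ y ∂G.measure, Tendsto (fun x => F (x - y)) l (𝓝 (g y))) :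
    Tendsto (fun x => ∫ y, F (x - y) ∂G.measure) l (𝓝 (∫ y, g y ∂G.measure)) :=
  tendsto_integral_filter_of_dominated_convergence (fun _ => (1 : ℝ))
    (Eventually.of_forall fun x => (F.measurable_shift x).aestronglyMeasurable)
    (Eventually.of_forall fun _ => ae_of_all _ fun _ => F.norm_le_one _)
    (integrable_const _) h

/-- The convolution product `F ⋆ G = ∫ F (· - y) dG(y)`. -/
def conv (F G : CDF) : CDF where
  toFun x := ∫ y, F (x - y) ∂G.measure
  mono' x₁ x₂ h := integral_mono (F.integrable_shift G x₁) (F.integrable_shift G x₂)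
    fun y => F.mono (sub_le_sub_right h y)
  right_continuous' x := by
    refine F.tendsto_integral_shift G (ae_of_all _ fun y => ?_)
    refine Tendsto.comp (F.right_continuous (x - y)) ?_
    refine tendsto_nhdsWithin_iff.2 ⟨?_, ?_⟩
    · exact ((continuous_id.sub continuous_const).tendsto x).mono_left nhdsWithin_le_nhds
    · filter_upwards [self_mem_nhdsWithin] with z hz
      exact sub_le_sub_right hz y
  tendsto_atBot := by
    have := F.tendsto_integral_shift G (l := atBot) (g := fun _ => 0) (ae_of_all _ fun y =>
      F.tendsto_atBot.comp (tendsto_atBot_add_const_right _ (-y) tendsto_id))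
    simpa using this
  tendsto_atTop := by
    have := F.tendsto_integral_shift G (l := atTop) (g := fun _ => 1) (ae_of_all _ fun y =>
      F.tendsto_atTop.comp (tendsto_atTop_add_const_right _ (-y) tendsto_id))
    simpa using this

theorem continuous_conv (F G : CDF) (hG : Continuous G) : Continuous (F.conv G) := by
  refine continuous_iff_continuousAt.2 fun x => ?_
  refine F.tendsto_integral_shift G ?_
  have hcount : {y : ℝ | ¬ ContinuousAt F (x - y)}.Countable :=
    (F.mono.countable_not_continuousAt).preimage (f := fun y : ℝ => x - y)
      (fun a b h => by simpa using h)
  have : NullSingletonClass G.measure := ⟨fun a => by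
    rw [measure, StieltjesFunction.measure_singleton,
      hG.continuousAt.continuousWithinAt.leftLim_eq]
    simp⟩
  filter_upwards [hcount.ae_notMem G.measure] with y hy
  have hy' : ContinuousAt F (x - y) := by simpa using hy
  exact Tendsto.comp hy' ((continuous_id.sub continuous_const).tendsto x)

/-- The uniform distance `sup_x |F x - G x|`, as an element of `[0,∞]`. -/
def uniformDist (F G : CDF) : ℝ≥0∞ := ⨆ x : ℝ, ENNReal.ofReal |F x - G x|

theorem uniformDist_self (F : CDF) : uniformDist F F = 0 := by
  simp [uniformDist]

theorem uniformDist_triangle (F H G : CDF) :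
    uniformDist F G ≤ uniformDist F H + uniformDist H G := by
  refine iSup_le fun x => ?_
  calc ENNReal.ofReal |F x - G x| ≤ ENNReal.ofReal (|F x - H x| + |H x - G x|) :=
        ENNReal.ofReal_le_ofReal (abs_sub_le _ _ _)
    _ ≤ ENNReal.ofReal |F x - H x| + ENNReal.ofReal |H x - G x| := ENNReal.ofReal_add_le
    _ ≤ _ := add_le_add (le_iSup (fun x => ENNReal.ofReal |F x - H x|) x)
        (le_iSup (fun x => ENNReal.ofReal |H x - G x|) x)

end CDF

/-- The continuous cdfs. -/
abbrev ContCDF : Type := {F : CDF // Continuous F}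

/-- The approach system of the uniform distance on the continuous cdfs. -/
def uniformApproach : ApproachSystem ContCDF :=
  ApproachSystem.ofDist (fun F G => CDF.uniformDist F.1 G.1)
    (fun F => CDF.uniformDist_self F.1) (fun F H G => CDF.uniformDist_triangle F.1 H.1 G.1)

/-- The continuity approach structure on the set of all cdfs: the initial approach structure for
the source `F ↦ F ⋆ G` into the continuous cdfs with the uniform distance, where `G` runs through
the continuous cdfs. -/
def continuityApproach : ApproachSystem CDF :=
  ApproachSystem.initial (ι := ContCDF) (Y := fun _ => ContCDF) (fun _ => uniformApproach)
    (fun G F => ⟨F.conv G.1, F.continuous_conv G.1 G.2⟩)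

/-- The escape index `inf_{M > 0} sup_{F ∈ D} max {F (-M), 1 - F M}`, computed in `[0,∞]` (so that
the supremum over the empty set is `0`). -/
def escapeIndex (D : Set CDF) : ℝ≥0∞ :=
  ⨅ (M : ℝ) (_ : 0 < M), ⨆ F ∈ D, ENNReal.ofReal (max (F (-M)) (1 - F M))

end

open Set

namespace ApproachSystem

/-! Two estimates meet. If the mass outside `(-M, M)` is at most `a` on each side for all members of
`D`, moving it to the endpoints changes each cdf by at most `a` uniformly, and convolving with a
probability measure preserves this bound. The truncated functions cannot lose mass, so Helly
selection yields a limit that is a cdf. Convolution with a continuous `G` ignores its countably many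
discontinuities, and Pólya's theorem makes the convergence of the convolutions uniform. The only
loss is `a` (`CDF.isRelSeqCompactUpTo_of_tails_le`). Conversely, a single test function `G`, uniform
on `[0,1]`, detects escaping mass: smoothing by it shifts a cdf by at most one unit, so a tail
exceeding `α` is incompatible with `α`-convergence to a cdf
(`escapeIndex_le_of_isRelSeqCompactUpTo`). -/

/-- Eventual bounds below `ε` for all component distances give `ε`-convergence in the initial
approach system. -/
theorem convergesUpTo_initial {X ι : Type*} {Y : ι → Type*} (S : ∀ i, ApproachSystem (Y i))
    (f : ∀ i, X → Y i) {a ε : ℝ} (haε : a < ε) (hε : 0 < ε) {u : ℕ → X} {x : X}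
    (h : ∀ i, ∀ ψ ∈ (S i).system (f i x), ∀ᶠ n in atTop, ψ (f i (u n)) ≤ ENNReal.ofReal a) :
    (initial S f).ConvergesUpTo ε u x := by
  intro φ hφ
  have haε' : ENNReal.ofReal a < ENNReal.ofReal ε := (ENNReal.ofReal_lt_ofReal_iff hε).2 haε
  obtain ⟨δ, hδ, hlt⟩ : ∃ δ : ℝ≥0∞, 0 < δ ∧ ENNReal.ofReal a + δ < ENNReal.ofReal ε := by
    obtain ⟨c, hac, hcε⟩ := exists_between haε'
    exact ⟨c - ENNReal.ofReal a, tsub_pos_of_lt hac, by rwa [add_tsub_cancel_of_le hac.le]⟩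
  -- Cutting off at the target radius loses nothing: `min φ ε < ε` already forces `φ < ε`.
  obtain ⟨b, ⟨J, ψ, hψ, rfl⟩, hle⟩ := hφ δ hδ (ENNReal.ofReal ε) ENNReal.ofReal_lt_top
  filter_upwards [(Finset.eventually_all J).2 fun i hi => h i (ψ i) (hψ i hi)] with n hn
  have hmin : min (φ (u n)) (ENNReal.ofReal ε) < ENNReal.ofReal ε :=
    (hle (u n)).trans_lt (lt_of_le_of_lt (by gcongr; exact Finset.sup_le hn) hlt)
  exact (min_lt_iff.1 hmin).resolve_right (lt_irrefl _)

end ApproachSystem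

/-! ### Helly selection and Pólya's theorem -/

/-- **Helly's selection theorem** for monotone functions `ℝ → [0,1]`. -/
theorem exists_subseq_tendsto_of_monotone {u : ℕ → ℝ → ℝ} (hmono : ∀ n, Monotone (u n))
    (hu : ∀ n x, u n x ∈ Icc (0 : ℝ) 1) :
    ∃ k : ℕ → ℕ, StrictMono k ∧ ∃ f : ℝ → ℝ, Monotone f ∧
      (∃ l : Filter ℕ, l.NeBot ∧ ∀ x, Tendsto (fun n => u (k n) x) l (𝓝 (f x))) ∧
      ∀ x, ContinuousAt f x → Tendsto (fun n => u (k n) x) atTop (𝓝 (f x)) := by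
  have hcomp : IsCompact (Set.pi univ fun _ : ℚ => Icc (0 : ℝ) 1) :=
    isCompact_univ_pi fun _ => isCompact_Icc
  obtain ⟨g, -, k, hk, hg⟩ :=
    hcomp.tendsto_subseq (x := fun n (q : ℚ) => u n q) fun n q _ => hu n q
  rw [tendsto_pi_nhds] at hg
  -- Diagonal extraction controls only rational points. A limit along a free ultrafilter defines `f`
  -- at every real point, is automatically monotone, and agrees with `g` on the rationals.
  have hlim : ∀ x, ∃ y, Tendsto (fun n : ℕ => u (k n) x) (hyperfilter ℕ : Filter ℕ) (𝓝 y) := by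
    intro x
    obtain ⟨y, -, hy⟩ := (isCompact_Icc (a := (0 : ℝ)) (b := 1)).ultrafilter_le_nhds
      ((hyperfilter ℕ).map fun n : ℕ => u (k n) x)
      (le_principal_iff.2 (Ultrafilter.mem_map.2
        (univ_mem' fun n => hu (k n) x)))
    exact ⟨y, hy⟩
  choose f hf using hlim
  have hfmono : Monotone f := fun x y hxy =>
    le_of_tendsto_of_tendsto (hf x) (hf y) (Eventually.of_forall fun n => hmono (k n) hxy)
  have hfq : ∀ q : ℚ, Tendsto (fun n => u (k n) q) atTop (𝓝 (f q)) := by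
    intro q
    have : f q = g q := tendsto_nhds_unique (hf q) ((hg q).mono_left Nat.hyperfilter_le_atTop)
    rw [this]
    exact hg q
  refine ⟨k, hk, f, hfmono, ⟨_, inferInstance, hf⟩, fun x hx => ?_⟩
  rw [tendsto_order]
  constructor
  -- At a continuity point, monotonicity traps `u (k n) x` between values at nearby rationals.
  · intro a ha
    obtain ⟨l, hl, hlx⟩ := exists_Ioc_subset_of_mem_nhds (hx.eventually (lt_mem_nhds ha))
      (exists_lt x)
    obtain ⟨q, hq1, hq2⟩ := exists_rat_btwn hl
    have hfa : a < f q := hlx ⟨hq1, hq2.le⟩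
    filter_upwards [(hfq q).eventually (lt_mem_nhds hfa)] with n hn
    exact hn.trans_le (hmono _ hq2.le)
  · intro a ha
    obtain ⟨l, hl, hlx⟩ := exists_Ico_subset_of_mem_nhds (hx.eventually (gt_mem_nhds ha))
      (exists_gt x)
    obtain ⟨q, hq1, hq2⟩ := exists_rat_btwn hl
    have hfa : f q < a := hlx ⟨hq1.le, hq2⟩
    filter_upwards [(hfq q).eventually (gt_mem_nhds hfa)] with n hn
    exact (hmono _ hq1.le).trans_lt hn

namespace CDF

/-- **Pólya's theorem**: pointwise convergence of monotone functions `ℝ → [0,1]` to a continuous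
cdf is uniform. -/
theorem eventually_abs_sub_le_of_tendsto {H : CDF} (hH : Continuous H) {u : ℕ → ℝ → ℝ}
    (hmono : ∀ n, Monotone (u n)) (hu : ∀ n x, u n x ∈ Icc (0 : ℝ) 1)
    (hlim : ∀ x, Tendsto (fun n => u n x) atTop (𝓝 (H x))) {ε : ℝ} (hε : 0 < ε) :
    ∀ᶠ n in atTop, ∀ x, |u n x - H x| ≤ ε := by
  have hclose : ∀ x, ∀ᶠ n in atTop, |u n x - H x| < ε / 2 := fun x => by
    simpa [Real.dist_eq] using (hlim x).eventually (Metric.ball_mem_nhds _ (half_pos hε))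
  obtain ⟨a, ha⟩ := (H.tendsto_atBot.eventually (gt_mem_nhds (half_pos hε))).exists
  obtain ⟨b, hb⟩ := (H.tendsto_atTop.eventually
    (lt_mem_nhds (show 1 - ε / 2 < (1 : ℝ) by linarith))).exists
  have hmid : ∀ᶠ n in atTop, ∀ x ∈ Icc a b, |u n x - H x| ≤ ε := by
    refine (isCompact_Icc (a := a) (b := b)).induction_on
      (p := fun s => ∀ᶠ n in atTop, ∀ x ∈ s, |u n x - H x| ≤ ε) (by simp) ?_ ?_ ?_
    · intro s t hst ht
      filter_upwards [ht] with n hn x hx using hn x (hst hx)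
    · intro s t hs ht
      filter_upwards [hs, ht] with n h1 h2 x hx using hx.elim (h1 x) (h2 x)
    · intro x _
      -- Error budget near `x`: `ε / 2` for convergence at the two nodes `x ± δ / 2`, and `ε / 4`
      -- for the variation of `H` on each side.
      obtain ⟨δ, hδ, hx⟩ := Metric.continuousAt_iff.1 (hH.continuousAt (x := x)) (ε / 4)
        (by positivity)
      have hl := hx (x := x - δ / 2) (by rw [Real.dist_eq, abs_lt]; constructor <;> linarith)
      have hr := hx (x := x + δ / 2) (by rw [Real.dist_eq, abs_lt]; constructor <;> linarith)
      rw [Real.dist_eq, abs_lt] at hl hr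
      refine ⟨Icc (x - δ / 2) (x + δ / 2),
        mem_nhdsWithin_of_mem_nhds (Icc_mem_nhds (by linarith) (by linarith)), ?_⟩
      filter_upwards [hclose (x - δ / 2), hclose (x + δ / 2)] with n h1 h2 y hy
      rw [abs_lt] at h1 h2
      have h3 := hmono n hy.1
      have h4 := hmono n hy.2
      have h5 := H.mono hy.1
      have h6 := H.mono hy.2
      rw [abs_le]
      constructor <;> linarith
  filter_upwards [hmid, hclose a, hclose b] with n hn h1 h2 x
  rw [abs_lt] at h1 h2
  rcases le_or_gt x a with hxa | hxa
  · have h3 := hmono n hxa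
    have h4 := H.mono hxa
    have h5 := H.nonneg x
    have h6 := (hu n x).1
    rw [abs_le]
    constructor <;> linarith
  rcases le_or_gt x b with hxb | hxb
  · exact hn x ⟨hxa.le, hxb⟩
  · have h3 := hmono n hxb.le
    have h4 := H.mono hxb.le
    have h5 := H.le_one x
    have h6 := (hu n x).2
    rw [abs_le]
    constructor <;> linarith

theorem conv_apply (F G : CDF) (x : ℝ) : F.conv G x = ∫ y, F (x - y) ∂G.measure := rfl

theorem nullSingletonClass_measure {G : CDF} (hG : Continuous G) :
    NullSingletonClass G.measure := ⟨fun a => by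
  rw [measure, StieltjesFunction.measure_singleton,
    hG.continuousAt.continuousWithinAt.leftLim_eq]
  simp⟩

/-! ### Truncation and compactness -/

/-- The function `F` with all mass outside `(-M, M)` moved to `-M` and `M`. -/
noncomputable def truncate (F : CDF) (M : ℝ) (x : ℝ) : ℝ :=
  if x < -M then 0 else if x < M then F x else 1

theorem truncate_mem_Icc (F : CDF) (M x : ℝ) : F.truncate M x ∈ Icc (0 : ℝ) 1 := by
  unfold truncate
  split_ifs
  · simp
  · exact ⟨F.nonneg x, F.le_one x⟩
  · simp

theorem monotone_truncate (F : CDF) (M : ℝ) : Monotone (F.truncate M) := by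
  intro x y hxy
  have h0 := F.nonneg y
  have h1 := F.le_one x
  have h2 := F.mono hxy
  unfold truncate
  split_ifs <;> linarith

theorem abs_sub_truncate_le {F : CDF} {M a : ℝ} (ha : 0 ≤ a) (hbot : F (-M) ≤ a)
    (htop : 1 - F M ≤ a) (x : ℝ) : |F x - F.truncate M x| ≤ a := by
  have h0 := F.nonneg x
  have h1 := F.le_one x
  unfold truncate
  split_ifs with hx hx'
  · rw [sub_zero, abs_of_nonneg h0]
    exact (F.mono hx.le).trans hbot
  · simpa using ha
  · rw [abs_sub_comm, abs_of_nonneg (by linarith)]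
    linarith [F.mono (not_lt.1 hx')]

/-- Cdfs with tails of mass at most `a` outside a fixed interval are, up to `a`, relatively
sequentially compact in the continuity approach structure. -/
theorem isRelSeqCompactUpTo_of_tails_le {D : Set CDF} {M a ε : ℝ} (hM : 0 < M) (ha : 0 ≤ a)
    (haε : a < ε) (hbot : ∀ F ∈ D, F (-M) ≤ a) (htop : ∀ F ∈ D, 1 - F M ≤ a) :
    continuityApproach.IsRelSeqCompactUpTo ε D := by
  intro u hu
  obtain ⟨k, hk, f, hf, ⟨l, hl, hfl⟩, hlim⟩ :=
    exists_subseq_tendsto_of_monotone (fun n => (u n).monotone_truncate M)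
      (fun n x => (u n).truncate_mem_Icc M x)
  -- Convergence along `l` holds at every point, so the values of `f` outside `[-M, M)` are known
  -- without any continuity. This is what prevents loss of mass.
  have hf0 : ∀ x < -M, f x = 0 := fun x hx =>
    tendsto_nhds_unique (hfl x) (by simp [truncate, hx])
  have hf1 : ∀ x, M ≤ x → f x = 1 := fun x hx =>
    tendsto_nhds_unique (hfl x) (by
      simp [truncate, not_lt.2 hx, not_lt.2 (show -M ≤ x by linarith)])
  have hf_le : ∀ x, f x ≤ 1 := fun x =>
    (hf (le_max_left x M)).trans (hf1 _ (le_max_right x M)).le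
  -- The right-continuous version of `f`, which differs from `f` only at discontinuities.
  let F : CDF :=
    { hf.stieltjesFunction with
      tendsto_atBot := by
        refine tendsto_const_nhds.congr' ?_
        filter_upwards [Iio_mem_atBot (-M)] with x hx
        obtain ⟨y, hxy, hy⟩ := exists_between (mem_Iio.1 hx)
        exact le_antisymm ((hf0 x hx).symm.le.trans (hf.le_rightLim le_rfl))
          ((hf.rightLim_le hxy).trans (hf0 y hy).le)
      tendsto_atTop := by
        refine tendsto_const_nhds.congr' ?_
        filter_upwards [Ici_mem_atTop M] with x hx
        exact le_antisymm ((hf1 x hx).symm.le.trans (hf.le_rightLim le_rfl))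
          ((hf.rightLim_le (lt_add_one x)).trans (hf_le _)) }
  have hFf : ∀ x, ContinuousAt f x → F x = f x := fun x hx =>
    hx.continuousWithinAt.rightLim_eq
  refine ⟨k, hk, F, ?_⟩
  -- The budget `b` splits into `a` for truncation and `b - a > 0` for Pólya's theorem.
  obtain ⟨b, hab, hbε⟩ := exists_between haε
  refine ApproachSystem.convergesUpTo_initial _ _ hbε (ha.trans_lt haε) fun G ψ hψ => ?_
  have hint : ∀ n x, Integrable (fun y => (u (k n)).truncate M (x - y)) G.1.measure :=
    fun n x => (integrable_const (1 : ℝ)).mono'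
      (((u (k n)).monotone_truncate M).measurable.comp
        (measurable_const.sub measurable_id)).aestronglyMeasurable
      (ae_of_all _ fun y => by
        have := (u (k n)).truncate_mem_Icc M (x - y)
        rw [Real.norm_eq_abs, abs_of_nonneg this.1]
        exact this.2)
  have hunif := eventually_abs_sub_le_of_tendsto (F.continuous_conv G.1 G.2)
    (u := fun n x => ∫ y, (u (k n)).truncate M (x - y) ∂G.1.measure) (ε := b - a)
    (fun n x x' hx => integral_mono (hint n x) (hint n x')
      fun y => (u (k n)).monotone_truncate M (sub_le_sub_right hx y))
    (fun n x => ⟨integral_nonneg fun y => ((u (k n)).truncate_mem_Icc M (x - y)).1, by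
      simpa using integral_mono (hint n x) (integrable_const (1 : ℝ))
        fun y => ((u (k n)).truncate_mem_Icc M (x - y)).2⟩)
    (fun x => by
      refine tendsto_integral_of_dominated_convergence (fun _ => (1 : ℝ))
        (fun n => (hint n x).aestronglyMeasurable) (integrable_const _)
        (fun n => ae_of_all _ fun y => ?_) ?_
      · have := (u (k n)).truncate_mem_Icc M (x - y)
        rw [Real.norm_eq_abs, abs_of_nonneg this.1]
        exact this.2
      -- Only countably many `y` make `x - y` a discontinuity of `f`, and `dG` has no atoms.
      · have hcount : {y : ℝ | ¬ ContinuousAt f (x - y)}.Countable :=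
          hf.countable_not_continuousAt.preimage (f := fun y : ℝ => x - y)
            (fun a b h => by simpa using h)
        have := nullSingletonClass_measure G.2
        filter_upwards [hcount.ae_notMem G.1.measure] with y hy
        have hy' : ContinuousAt f (x - y) := by simpa using hy
        rw [hFf _ hy']
        exact hlim _ hy')
    (sub_pos.2 hab)
  filter_upwards [hunif] with n hn
  refine (hψ _).trans (iSup_le fun x => ENNReal.ofReal_le_ofReal ?_)
  have h1 : |(u (k n)).conv G.1 x - ∫ y, (u (k n)).truncate M (x - y) ∂G.1.measure| ≤ a := by
    rw [conv_apply, ← integral_sub ((u (k n)).integrable_shift G.1 x) (hint n x)]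
    simpa using norm_integral_le_of_norm_le_const (μ := G.1.measure) (C := a)
      (f := fun y => u (k n) (x - y) - (u (k n)).truncate M (x - y))
      (ae_of_all _ fun y => abs_sub_truncate_le ha (hbot _ (hu (k n))) (htop _ (hu (k n))) (x - y))
  have h2 := hn x
  calc |F.conv G.1 x - (u (k n)).conv G.1 x|
      = |(u (k n)).conv G.1 x - F.conv G.1 x| := abs_sub_comm _ _
    _ ≤ _ := abs_sub_le _ (∫ y, (u (k n)).truncate M (x - y) ∂G.1.measure) _
    _ ≤ a + (b - a) := add_le_add h1 h2
    _ = b := by ring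

/-! ### Smoothing by the uniform distribution -/

/-- The cdf of the uniform distribution on `[0,1]`. -/
def uniform : CDF where
  toFun x := max 0 (min 1 x)
  mono' _ _ h := max_le_max_left 0 (min_le_min_left 1 h)
  right_continuous' _ :=
    (continuous_const.max (continuous_const.min continuous_id)).continuousWithinAt
  tendsto_atBot := by
    refine tendsto_const_nhds.congr' ?_
    filter_upwards [Iic_mem_atBot (0 : ℝ)] with x hx
    exact (max_eq_left ((min_le_right _ _).trans hx)).symm
  tendsto_atTop := by
    refine tendsto_const_nhds.congr' ?_
    filter_upwards [Ici_mem_atTop (1 : ℝ)] with x hx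
    show (1 : ℝ) = max 0 (min 1 x)
    rw [min_eq_left hx, max_eq_right zero_le_one]

theorem continuous_uniform : Continuous uniform :=
  continuous_const.max (continuous_const.min continuous_id)

theorem ae_mem_Ioc_uniform : ∀ᵐ y ∂uniform.measure, y ∈ Ioc (0 : ℝ) 1 := by
  refine (mem_ae_iff_prob_eq_one measurableSet_Ioc).2 ?_
  rw [measure, StieltjesFunction.measure_Ioc]
  change ENNReal.ofReal (max 0 (min 1 1) - max 0 (min 1 0)) = 1
  simp

theorem conv_uniform_le (F : CDF) (x : ℝ) : F.conv uniform x ≤ F x := by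
  rw [conv_apply]
  refine (integral_mono_ae (F.integrable_shift uniform x) (integrable_const (F x)) ?_).trans
    (by simp)
  filter_upwards [ae_mem_Ioc_uniform] with y hy
  exact F.mono (by linarith [hy.1])

/-- The mass of `uniform` lies in `(0, 1]`, so smoothing delays `F` by at most one unit. -/
theorem le_conv_uniform (F : CDF) (x : ℝ) : F (x - 1) ≤ F.conv uniform x := by
  rw [conv_apply]
  refine le_trans (by simp) (integral_mono_ae (integrable_const (F (x - 1)))
    (F.integrable_shift uniform x) ?_)
  filter_upwards [ae_mem_Ioc_uniform] with y hy
  exact F.mono (by linarith [hy.2])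

end CDF

/-! ### The two inequalities -/

/-- The identity is a contraction, so by the universal property each map `H ↦ H ⋆ G` is one and
pulls local distances back to local distances. -/
theorem uniformDist_conv_mem_continuityApproach (F : CDF) (G : ContCDF) :
    (fun H : CDF => CDF.uniformDist (F.conv G.1) (H.conv G.1)) ∈ continuityApproach.system F :=
  (ApproachSystem.isContraction_initial_iff _ _ continuityApproach id).1
    (fun _ _ h => h) G F (fun H => CDF.uniformDist (F.conv G.1) H.1)
      (le_refl (fun H : ContCDF => CDF.uniformDist (F.conv G.1) H.1))

/-- Otherwise some `β > α` is exceeded by tails at every scale. Far out, the smoothed limit has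
tails below `β - α`, while the smoothed sequence still has a tail above `β`: their distance exceeds
`α`. -/
theorem escapeIndex_le_of_isRelSeqCompactUpTo {D : Set CDF} {α : ℝ} (hα : 0 < α)
    (hD : continuityApproach.IsRelSeqCompactUpTo α D) : escapeIndex D ≤ ENNReal.ofReal α := by
  by_contra! hlt
  obtain ⟨β, -, hαβ, hβ⟩ := ENNReal.lt_iff_exists_real_btwn.1 hlt
  have hαβ' : α < β := (ENNReal.ofReal_lt_ofReal_iff_of_nonneg hα.le).1 hαβ
  -- Taking `n + 1` makes the radius positive and also absorbs the unit shift in `le_conv_uniform`.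
  have hex : ∀ n : ℕ, ∃ F ∈ D, β < max (F (-(n + 1 : ℝ))) (1 - F (n + 1)) := by
    intro n
    have h : ENNReal.ofReal β <
        ⨆ F ∈ D, ENNReal.ofReal (max (F (-(n + 1 : ℝ))) (1 - F (n + 1))) :=
      hβ.trans_le (iInf₂_le (n + 1 : ℝ) (by positivity))
    simp only [lt_iSup_iff] at h
    obtain ⟨F, hF, h⟩ := h
    exact ⟨F, hF, (ENNReal.ofReal_lt_ofReal_iff_of_nonneg (hα.trans hαβ').le).1 h⟩
  choose u hu hβu using hex
  obtain ⟨k, hk, F, hF⟩ := hD u hu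
  let G : ContCDF := ⟨CDF.uniform, CDF.continuous_uniform⟩
  obtain ⟨a, ha⟩ := ((F.conv CDF.uniform).tendsto_atBot.eventually
    (gt_mem_nhds (sub_pos.2 hαβ'))).exists
  obtain ⟨b, hb⟩ := ((F.conv CDF.uniform).tendsto_atTop.eventually
    (lt_mem_nhds (show 1 - (β - α) < (1 : ℝ) by linarith))).exists
  have hkR : Tendsto (fun n => (k n : ℝ)) atTop atTop :=
    tendsto_natCast_atTop_atTop.comp hk.tendsto_atTop
  obtain ⟨n, hn, hna, hnb⟩ := ((hF _ (uniformDist_conv_mem_continuityApproach F G)).and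
    ((hkR.eventually_ge_atTop (-a)).and (hkR.eventually_ge_atTop b))).exists
  have hdist : ∀ x, |F.conv CDF.uniform x - (u (k n)).conv CDF.uniform x| < α := fun x =>
    (ENNReal.ofReal_lt_ofReal_iff hα).1 ((le_iSup (fun x => ENNReal.ofReal
      |F.conv CDF.uniform x - (u (k n)).conv CDF.uniform x|) x).trans_lt hn)
  rcases lt_max_iff.1 (hβu (k n)) with h | h
  · have h1 := (u (k n)).le_conv_uniform a
    have h2 := (u (k n)).mono (show -(k n + 1 : ℝ) ≤ a - 1 by linarith)
    have h3 := (abs_lt.1 (hdist a)).1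
    linarith
  · have h1 := (u (k n)).conv_uniform_le b
    have h2 := (u (k n)).mono (show b ≤ (k n + 1 : ℝ) by linarith)
    have h3 := (abs_lt.1 (hdist b)).2
    linarith

theorem relSeqCompactIndex_le_escapeIndex (D : Set CDF) :
    continuityApproach.relSeqCompactIndex D ≤ escapeIndex D := by
  refine le_of_forall_gt fun c hc => ?_
  simp only [escapeIndex, iInf_lt_iff] at hc
  obtain ⟨M, hM, hc⟩ := hc
  -- The strict gap between the tail bound and `ε` is the room that the compactness lemma needs.
  obtain ⟨ε, -, hε, hεc⟩ := ENNReal.lt_iff_exists_real_btwn.1 hc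
  set s := ⨆ F ∈ D, ENNReal.ofReal (max (F (-M)) (1 - F M)) with hs
  have hε0 : 0 < ε := ENNReal.ofReal_pos.1 (bot_le.trans_lt hε)
  have hs_top : s ≠ ∞ := hε.ne_top
  have htail : ∀ F ∈ D, max (F (-M)) (1 - F M) ≤ s.toReal := fun F hF =>
    (ENNReal.ofReal_le_iff_le_toReal hs_top).1
      (le_iSup₂ (f := fun (F : CDF) (_ : F ∈ D) => ENNReal.ofReal (max (F (-M)) (1 - F M))) F hF)
  have hcomp : continuityApproach.IsRelSeqCompactUpTo ε D :=
    CDF.isRelSeqCompactUpTo_of_tails_le hM ENNReal.toReal_nonneg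
      ((ENNReal.lt_ofReal_iff_toReal_lt hs_top).1 hε)
      (fun F hF => (le_max_left _ _).trans (htail F hF))
      (fun F hF => (le_max_right _ _).trans (htail F hF))
  exact (iInf_le_of_le ε (iInf₂_le_of_le hε0 hcomp le_rfl)).trans_lt hεc

theorem theorem3p13 (D : Set CDF) :
    continuityApproach.relSeqCompactIndex D = escapeIndex D :=
  le_antisymm (relSeqCompactIndex_le_escapeIndex D)
    (le_iInf fun _ => le_iInf₂ fun hα hD => escapeIndex_le_of_isRelSeqCompactUpTo hα hD)
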